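/- **Setting.** A *query search problem* $R$ is a sequence of relations: for every $n$, inputs are strings $x\in A_n^{V_n}$ (positions in a finite set $V_n$, symbols in a finite alphabet $A_n$), candidate solutions lie in a finite set $O_n$, and $R_n\subseteq A_n^{V_n}\times O_n$ is the solution relation. Algorithms are (nonuniform) decision trees that query the symbols of $x$. Put $\ell_R(n)=\lceil\log_2|V_n|\rceil+\lceil\log_2|A_n|\rceil$ (each logarithm read as $0$ when the set is empty); a quantity is called *polylogarithmic* if it is at most $p(\ell_R(n))$ for all $n$, for one fixed polynomial $p$. $R$ is in *black-box TFNP* if every input has a solution, $\lceil\log_2|O_n|\rceil$ is polylogarithmic, and for every $o\in O_n$ a decision tree of polylogarithmic depth decides whether $(x,o)\in R_n$. An *$S$-formulation* of $R_n$ consists of a number $m$, for each position $v$ of an input of $S_m$ a decision tree $T_v$ over $x$ whose output is a symbol of the alphabet of $S_m$, and for each candidate solution $s$ of $S_m$ a decision tree $B_s$ over $x$, such that for every $x$: if $s$ solves the input $(T_v(x))_v$ of $S_m$, then $B_s(x)$ solves the input $x$ of $R_n$. $R$ has *shallow* $S$-formulations if every $R_n$ has one in which all trees $T_v,B_s$ have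 polylogarithmic depth (there is no bound on $m$). $R$ is *many-one reducible* to $S$ if moreover $\ell_S(m)$ is polylogarithmic. An *oracle decision tree* may in addition call, adaptively and repeatedly, an oracle for $S$, on an input of some $S_m$ each symbol of which is computed by a decision tree over $x$; it branches on the solution returned. Its cost is the maximum over branches of the number of queries plus, for every call, $1+\ell_S(m)$ plus the largest depth of the trees describing the instance. It solves $R_n$ if on every $x$ it outputs a solution of $x$ whatever correct solutions the oracle returns. $R$ is *adaptively Turing reducible* to $S$ if every $R_n$ is solved by such a tree of polylogarithmic cost. **Problems.** *Collision*: given $C:\{0,1\}^{n+1}\to\{0,1\}^{n}$ (as a table of values), find $x_1\ne x_2$ with $C(x_1)=C(x_2)$. *NestedCollision*: given $f:\{0,1\}^{n+1}\to\{0,1\}^{n}$ and $g:\{0,1\}^{n+1}\times\{0,1\}^{n+1}\times\{0,1\}^{n+1}\to\{0,1\}^{n}$ (as tables of values), find $x_1\neq x_2$ and $y_1\ne y_2$ with $f(x_1)=f(x_2)$ and $g(x_1,x_2,y_1)=g(x_1,x_2,y_2)$. *Black-box PWPP* is the class of problems in black-box TFNP that are many-one reducible to Collision. **Theorem (black-box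 PWPP is not Turing-closed).** 1. NestedCollision has no shallow Collision-formulations. 2. NestedCollision is in black-box TFNP, and it is solved by oracle decision trees of polylogarithmic cost that make at most two (adaptive) calls to Collision. 3. Hence black-box PWPP is not closed under adaptive Turing reductions: there are a problem $R$ in black-box TFNP and a problem $S$ in black-box PWPP such that $R$ is adaptively Turing reducible to $S$, but $R$ is not in black-box PWPP. -/

import Mathlib

/-- Decision trees that query an input `x : V → A`, one symbol at a time, and output an element
of `β`. The subtree taken after a query depends on the symbol that was read. -/
inductive DecTree (V A β : Type) : Type
  | leaf (b : β) : DecTree V A β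
  | query (v : V) (next : A → DecTree V A β) : DecTree V A β

namespace DecTree

/-- The output of a decision tree on the input `x`. -/
def eval {V A β : Type} (x : V → A) : DecTree V A β → β
  | leaf b => b
  | query v next => eval x (next (x v))

/-- The depth of a decision tree: the largest number of queries on a branch. -/
def depth {V A β : Type} [Fintype A] : DecTree V A β → ℕ
  | leaf _ => 0
  | query _ next => 1 + Finset.univ.sup fun a => depth (next a)

end DecTree

/-- A query (black-box) search problem: for every index `n`, inputs are strings of symbols from a
finite alphabet `Alph n`, with positions in a finite set `Var n`; the candidate solutions form a
finite set `Sol n`, and `Rel n x s` says that `s` is a solution on input `x`. -/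
structure QueryProblem where
  Var : ℕ → Type
  Alph : ℕ → Type
  Sol : ℕ → Type
  fintypeVar : ∀ n, Fintype (Var n)
  fintypeAlph : ∀ n, Fintype (Alph n)
  fintypeSol : ∀ n, Fintype (Sol n)
  Rel : ∀ n, (Var n → Alph n) → Sol n → Prop

attribute [instance] QueryProblem.fintypeVar QueryProblem.fintypeAlph QueryProblem.fintypeSol

namespace QueryProblem

/-- The number of bits needed to write down one position and one symbol of an `n`-th input.
"Polylogarithmic" always means: bounded by a polynomial in this quantity. -/
def logSize (R : QueryProblem) (n : ℕ) : ℕ :=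
  Nat.clog 2 (Fintype.card (R.Var n)) + Nat.clog 2 (Fintype.card (R.Alph n))

/-- Black-box TFNP: every input has a solution, solutions have polylogarithmic length, and
solutions are verified by decision trees of polylogarithmic depth. -/
def InTFNP (R : QueryProblem) : Prop :=
  (∀ n x, ∃ s, R.Rel n x s) ∧
  ∃ p : Polynomial ℕ, ∀ n,
    Nat.clog 2 (Fintype.card (R.Sol n)) ≤ p.eval (R.logSize n) ∧
    ∀ s : R.Sol n, ∃ T : DecTree (R.Var n) (R.Alph n) Bool,
      T.depth ≤ p.eval (R.logSize n) ∧ ∀ x, T.eval x = true ↔ R.Rel n x s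

/-- An `S`-formulation of the `n`-th instance of `R` (a many-one reduction to `S` by decision
trees): decision trees that compute, from an input `x` of `R`, every symbol of an input of the
`m`-th instance of `S`, and, for every candidate solution `s` of `S`, a decision tree that maps
it back to a candidate solution of `R`, such that solutions are mapped to solutions. -/
structure Formulation (R S : QueryProblem) (n : ℕ) where
  m : ℕ
  inst : S.Var m → DecTree (R.Var n) (R.Alph n) (S.Alph m)
  back : S.Sol m → DecTree (R.Var n) (R.Alph n) (R.Sol n)
  correct : ∀ (x : R.Var n → R.Alph n) (s : S.Sol m),
    S.Rel m (fun v => (inst v).eval x) s → R.Rel n x ((back s).eval x)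

/-- All decision trees of the formulation have depth at most `d`. -/
def Formulation.DepthLE {R S : QueryProblem} {n : ℕ} (F : Formulation R S n) (d : ℕ) : Prop :=
  (∀ v, (F.inst v).depth ≤ d) ∧ ∀ s, (F.back s).depth ≤ d

/-- `R` has `S`-formulations of polylogarithmic depth (and of unrestricted size). -/
def HasShallowFormulation (R S : QueryProblem) : Prop :=
  ∃ p : Polynomial ℕ, ∀ n, ∃ F : Formulation R S n, F.DepthLE (p.eval (R.logSize n))

/-- `R` is black-box many-one reducible to `S`: it has `S`-formulations of polylogarithmic depth
and of quasi-polynomial size. -/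
def ManyOneReducible (R S : QueryProblem) : Prop :=
  ∃ p : Polynomial ℕ, ∀ n, ∃ F : Formulation R S n,
    F.DepthLE (p.eval (R.logSize n)) ∧ S.logSize F.m ≤ p.eval (R.logSize n)

/-- Adaptive decision trees with input `x : V → A` and an oracle for `S`. Besides querying `x`,
such a tree can call the oracle on an input of `S` each symbol of which is computed from `x` by a
decision tree. What happens next depends on the solution that the oracle returns. -/
inductive OracleTree (S : QueryProblem) (V A β : Type) : Type
  | leaf (b : β) : OracleTree S V A β
  | query (v : V) (next : A → OracleTree S V A β) : OracleTree S V A β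
  | call (m : ℕ) (inst : S.Var m → DecTree V A (S.Alph m))
      (next : S.Sol m → OracleTree S V A β) : OracleTree S V A β

namespace OracleTree

/-- `b` is a possible output on input `x`, where every oracle call may be answered by an arbitrary
solution of the instance on which the oracle is called. -/
def Outputs {S : QueryProblem} {V A β : Type} (x : V → A) : OracleTree S V A β → β → Prop
  | leaf b', b => b' = b
  | query v next, b => Outputs x (next (x v)) b
  | call m inst next, b =>
      ∃ s, S.Rel m (fun v => (inst v).eval x) s ∧ Outputs x (next s) b

/-- The largest cost of a branch. A query costs `1`. An oracle call costs `1`, plus the logarithm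
of the size of the instance, plus the largest depth of the trees that describe the instance. -/
def cost {S : QueryProblem} {V A β : Type} [Fintype A] : OracleTree S V A β → ℕ
  | leaf _ => 0
  | query _ next => 1 + Finset.univ.sup fun a => cost (next a)
  | call m inst next =>
      1 + S.logSize m + (Finset.univ.sup fun v => (inst v).depth) +
        Finset.univ.sup fun s => cost (next s)

/-- The largest number of oracle calls on a branch. -/
def calls {S : QueryProblem} {V A β : Type} [Fintype A] : OracleTree S V A β → ℕ
  | leaf _ => 0
  | query _ next => Finset.univ.sup fun a => calls (next a)
  | call _ _ next => 1 + Finset.univ.sup fun s => calls (next s)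

end OracleTree

/-- The tree solves the `n`-th instance of `R`, whatever solutions the oracle returns. -/
def SolvedBy (R S : QueryProblem) (n : ℕ)
    (T : OracleTree S (R.Var n) (R.Alph n) (R.Sol n)) : Prop :=
  ∀ x b, T.Outputs x b → R.Rel n x b

/-- `R` is black-box adaptively Turing reducible to `S`: it is solved by adaptive oracle decision
trees of polylogarithmic cost. -/
def TuringReducible (R S : QueryProblem) : Prop :=
  ∃ p : Polynomial ℕ, ∀ n, ∃ T : OracleTree S (R.Var n) (R.Alph n) (R.Sol n),
    SolvedBy R S n T ∧ T.cost ≤ p.eval (R.logSize n)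

end QueryProblem

/-- Bit strings of length `n`. -/
abbrev BitStr (n : ℕ) : Type := Fin n → Bool

/-- Collision: the input is a function `C` from `n + 1` bits to `n` bits; a solution is a pair of
distinct points with the same value. -/
def Collision : QueryProblem where
  Var n := BitStr (n + 1)
  Alph n := BitStr n
  Sol n := BitStr (n + 1) × BitStr (n + 1)
  fintypeVar _ := inferInstance
  fintypeAlph _ := inferInstance
  fintypeSol _ := inferInstance
  Rel _ C s := s.1 ≠ s.2 ∧ C s.1 = C s.2

/-- NestedCollision: the input is a pair of shrinking functions, `f` from `n + 1` bits to `n` bits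
(the positions `Sum.inl x`) and a family `g (x₁, x₂, ·)` of functions from `n + 1` bits to `n` bits
(the positions `Sum.inr (x₁, x₂, y)`). A solution `((x₁, x₂), (y₁, y₂))` consists of a collision
`x₁ ≠ x₂` of `f` and a collision `y₁ ≠ y₂` of the function `g (x₁, x₂, ·)` that it selects. -/
def NestedCollision : QueryProblem where
  Var n := BitStr (n + 1) ⊕ (BitStr (n + 1) × BitStr (n + 1) × BitStr (n + 1))
  Alph n := BitStr n
  Sol n := (BitStr (n + 1) × BitStr (n + 1)) × (BitStr (n + 1) × BitStr (n + 1))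
  fintypeVar _ := inferInstance
  fintypeAlph _ := inferInstance
  fintypeSol _ := inferInstance
  Rel _ h s :=
    (s.1.1 ≠ s.1.2 ∧ h (Sum.inl s.1.1) = h (Sum.inl s.1.2)) ∧
    (s.2.1 ≠ s.2.2 ∧
      h (Sum.inr (s.1.1, s.1.2, s.2.1)) = h (Sum.inr (s.1.1, s.1.2, s.2.2)))

/-- Black-box PWPP: the problems in black-box TFNP that are many-one reducible to Collision. -/
def InPWPP (R : QueryProblem) : Prop :=
  R.InTFNP ∧ R.ManyOneReducible Collision

/-- Black-box PWPP is closed under adaptive Turing reductions (within black-box TFNP). -/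
def PWPPTuringClosed : Prop :=
  ∀ R S : QueryProblem, R.InTFNP → InPWPP S → R.TuringReducible S → InPWPP R

/-!
The heart of the matter is that NestedCollision has no shallow Collision-formulation.

Let `N = 2 ^ n`, and suppose that decision trees of depth `d`, with `8 (d + 2)² < N`, describe an
instance of Collision with `2 ^ (m + 1)` points and `2 ^ m` values. Run the tree of a point `w` on
`f` and `g = 0`, and let it look at `f x₁` and `f x₂` whenever it queries `g (x₁, x₂, ·)`. Call `w`
*good* for `f` if these at most `2 d` queries to `f` meet no collision of `f`. By the birthday bound
(`DecTree.card_not_injOn_queried_le`) a point is not good with probability at most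
`4 d² / N < 1 / 2` over a random `f`, so for some `f` more than `2 ^ m` points are good
(`exists_card_lt_card_filter`). Two of them, `w₁ ≠ w₂`, have the same value, and they keep it if `g`
is changed at collisions of `f` only, where their trees never look. The tree that maps `(w₁, w₂)`
back to a solution has depth `d`. By the birthday bound again, now for a random choice of `g` at the
collisions of `f`, some such `g` takes pairwise distinct values at all positions there that this
tree queries or that its output names (`exists_not_rel_eval_maskedInput`). Its output is then not a
solution, a contradiction (`not_depthLE_of_lt`). The size of the Collision instance plays no role.

Conversely, two adaptive calls to Collision, first on `f` and then on the function `g (x₁, x₂, ·)`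
that the first answer selects, solve NestedCollision; this gives the other two statements.
-/

/-! ### Decision trees -/

namespace DecTree

variable {V A β V' A' γ : Type}

/-- The set of positions that a decision tree queries on the input `x`. -/
def queried (x : V → A) : DecTree V A β → Set V
  | leaf _ => ∅
  | query v next => insert v (queried x (next (x v)))

/-- The sequential composition of decision trees over the same input. -/
def bind (k : β → DecTree V A γ) : DecTree V A β → DecTree V A γ
  | leaf b => k b
  | query v next => query v fun a => bind k (next a)

/-- The tree that replaces every query of a position `v` by a run of `σ v`, and every leaf `b` by
the tree `k b`. -/
def simulate (σ : V → DecTree V' A' A) (k : β → DecTree V' A' γ) :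
    DecTree V A β → DecTree V' A' γ
  | leaf b => k b
  | query v next => (σ v).bind fun a => simulate σ k (next a)

lemma depth_next_le [Fintype A] {v : V} {next : A → DecTree V A β} {d : ℕ}
    (h : (query v next).depth ≤ d + 1) (a : A) : (next a).depth ≤ d := by
  have h1 : (next a).depth ≤ Finset.univ.sup fun a => (next a).depth :=
    Finset.le_sup (f := fun a => (next a).depth) (Finset.mem_univ a)
  simp only [depth] at h
  omega

lemma depth_query_le [Fintype A] {v : V} {next : A → DecTree V A β} {d : ℕ}
    (h : ∀ a, (next a).depth ≤ d) : (query v next).depth ≤ d + 1 := by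
  have h1 : (Finset.univ.sup fun a => (next a).depth) ≤ d := Finset.sup_le fun a _ => h a
  simp only [depth]
  omega

lemma exists_eq_add_one_of_depth_query_le [Fintype A] {v : V} {next : A → DecTree V A β} {d : ℕ}
    (h : (query v next).depth ≤ d) : ∃ e, d = e + 1 := by
  simp only [depth] at h
  exact ⟨d - 1, by omega⟩

lemma eval_congr {x y : V → A} (T : DecTree V A β) (h : ∀ v ∈ queried x T, y v = x v) :
    eval y T = eval x T := by
  induction T with
  | leaf b => rfl
  | query v next ih =>
    simp only [eval]
    rw [h v (Set.mem_insert _ _)]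
    exact ih _ fun w hw => h w (Set.mem_insert_of_mem _ hw)

lemma queried_bind (x : V → A) (k : β → DecTree V A γ) (T : DecTree V A β) :
    queried x (T.bind k) = queried x T ∪ queried x (k (T.eval x)) := by
  induction T with
  | leaf b => simp [bind, queried, eval]
  | query v next ih => simp only [bind, queried, eval, ih, Set.insert_union]

lemma depth_bind_le [Fintype A] {k : β → DecTree V A γ} {e : ℕ} (hk : ∀ b, (k b).depth ≤ e)
    (T : DecTree V A β) {d : ℕ} (hT : T.depth ≤ d) : (T.bind k).depth ≤ d + e := by
  induction T generalizing d with
  | leaf b => exact (hk b).trans (Nat.le_add_left _ _)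
  | query v next ih =>
    obtain ⟨d, rfl⟩ := exists_eq_add_one_of_depth_query_le hT
    rw [add_right_comm]
    exact depth_query_le fun a => ih a (depth_next_le hT a)

lemma queried_simulate (x : V' → A') (σ : V → DecTree V' A' A) (k : β → DecTree V' A' γ)
    (T : DecTree V A β) :
    queried x (T.simulate σ k) =
      (⋃ v ∈ queried (fun v => (σ v).eval x) T, queried x (σ v)) ∪
        queried x (k (T.eval fun v => (σ v).eval x)) := by
  induction T with
  | leaf b => simp [simulate, queried, eval]
  | query v next ih =>
    simp only [simulate, queried, eval, queried_bind, ih, Set.biUnion_insert, Set.union_assoc]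

lemma depth_simulate_le [Fintype A] [Fintype A'] {σ : V → DecTree V' A' A}
    {k : β → DecTree V' A' γ} {c e : ℕ} (hσ : ∀ v, (σ v).depth ≤ c) (hk : ∀ b, (k b).depth ≤ e)
    (T : DecTree V A β) {d : ℕ} (hT : T.depth ≤ d) : (T.simulate σ k).depth ≤ c * d + e := by
  induction T generalizing d with
  | leaf b => exact (hk b).trans (Nat.le_add_left _ _)
  | query v next ih =>
    obtain ⟨d, rfl⟩ := exists_eq_add_one_of_depth_query_le hT
    refine (depth_bind_le (fun a => ih a (depth_next_le hT a)) (σ v) (hσ v)).trans ?_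
    rw [mul_add]
    omega

end DecTree

/-! ### The birthday bound for decision trees -/

/-- Averaging over all functions may be done by first resampling one value. -/
lemma card_filter_mul_card_eq_sum_update {V A : Type} [Fintype V] [DecidableEq V] [Fintype A]
    (P : (V → A) → Prop) [DecidablePred P] (v : V) :
    (Finset.univ.filter P).card * Fintype.card A =
      ∑ b : A, (Finset.univ.filter fun x : V → A => P (Function.update x v b)).card := by
  have h1 : (Finset.univ.filter P).card * Fintype.card A =
      ((Finset.univ.filter P) ×ˢ (Finset.univ : Finset A)).card := by
    rw [Finset.card_product, Finset.card_univ]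
  rw [h1, ← Finset.card_sigma]
  -- the bijection swaps the value at `v` with the separate symbol
  refine Finset.card_bij' (fun p _ => ⟨p.1 v, Function.update p.1 v p.2⟩)
    (fun q _ => (Function.update q.2 v q.1, q.2 v)) ?_ ?_ ?_ ?_
  · rintro ⟨x, b⟩ h
    simpa using h
  · rintro ⟨b, x⟩ h
    simpa using h
  · rintro ⟨x, b⟩ _
    simp
  · rintro ⟨b, x⟩ _
    simp

open scoped Classical in
/-- Birthday bound. If the values on `S` are fixed to those of `a`, which are pairwise distinct, and
all other values are random, then a decision tree of depth `d` meets two positions with the same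
value with probability at most `d (|S| + d) / |A|`. -/
theorem DecTree.card_not_injOn_queried_le {V A β : Type} [Fintype V] [DecidableEq V] [Fintype A]
    (T : DecTree V A β) {d : ℕ} (hT : T.depth ≤ d) (S : Finset V) (a : V → A)
    (ha : Set.InjOn a S) :
    (Finset.univ.filter fun x : V → A =>
        ¬ Set.InjOn (S.piecewise a x) (S ∪ queried (S.piecewise a x) T)).card * Fintype.card A ≤
      d * (S.card + d) * Fintype.card (V → A) := by
  induction T generalizing d S a with
  | leaf b =>
    have h : ∀ x : V → A, Set.InjOn (S.piecewise a x) S := fun x =>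
      ha.congr fun v hv => (Finset.piecewise_eq_of_mem _ _ _ (Finset.mem_coe.1 hv)).symm
    simp [queried, h]
  | query v next ih =>
    obtain ⟨e, rfl⟩ := exists_eq_add_one_of_depth_query_le hT
    have hnext := depth_next_le hT
    by_cases hv : v ∈ S
    · have hU : ∀ Q : Set V, (S : Set V) ∪ insert v Q = (S : Set V) ∪ Q := fun Q => by
        exact Set.union_insert.trans (Set.insert_eq_of_mem (Or.inl (Finset.mem_coe.2 hv)))
      simp only [queried, hU, Finset.piecewise_eq_of_mem _ _ _ hv]
      refine (ih (a v) (hnext _) S a ha).trans ?_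
      gcongr <;> omega
    · rcases isEmpty_or_nonempty A with hA | hA
      · simp
      have hpos : 0 < Fintype.card A := Fintype.card_pos
      set M := Fintype.card (V → A) with hM
      refine Nat.le_of_mul_le_mul_right ?_ hpos
      rw [card_filter_mul_card_eq_sum_update (fun x : V → A =>
        ¬ Set.InjOn (S.piecewise a x) (S ∪ queried (S.piecewise a x) (query v next))) v,
        Finset.sum_mul]
      -- the answer `b` to the query either repeats a value on `S` or extends `S` injectively
      have hb : ∀ b : A, (Finset.univ.filter fun x : V → A =>
          ¬ Set.InjOn (S.piecewise a (Function.update x v b))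
            (S ∪ queried (S.piecewise a (Function.update x v b)) (query v next))).card *
            Fintype.card A ≤
          (if b ∈ S.image a then M * Fintype.card A else 0) + e * (S.card + 1 + e) * M := by
        intro b
        split_ifs with hbS
        · refine le_trans ?_ (Nat.le_add_right _ _)
          exact Nat.mul_le_mul_right _ (Finset.card_le_univ _)
        · have hpw : ∀ x : V → A, S.piecewise a (Function.update x v b) =
              (insert v S).piecewise (Function.update a v b) x := by
            intro x
            ext w
            by_cases hw : w = v
            · subst hw
              simp [hv]
            · by_cases hwS : w ∈ S <;> simp [Finset.piecewise, hw, hwS]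
          have hinj : Set.InjOn (Function.update a v b) (insert v S : Finset V) := by
            have hne : ∀ w ∈ S, w ≠ v := fun w hw h => hv (h ▸ hw)
            rw [Finset.coe_insert, Set.injOn_insert (by simpa using hv)]
            refine ⟨ha.congr fun w hw => ?_, ?_⟩
            · rw [Function.update_of_ne (hne w hw)]
            · rintro ⟨w, hw, h⟩
              rw [Function.update_self, Function.update_of_ne (hne w hw)] at h
              exact hbS (Finset.mem_image.2 ⟨w, hw, h⟩)
          have hQ : ∀ x : V → A,
              (S : Set V) ∪ queried ((insert v S).piecewise (Function.update a v b) x)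
                (query v next) =
              ((insert v S : Finset V) : Set V) ∪
                queried ((insert v S).piecewise (Function.update a v b) x) (next b) := by
            intro x
            simp [queried, Finset.piecewise, Set.insert_union]
          simp only [hpw, hQ]
          have := ih b (hnext b) (insert v S) (Function.update a v b) hinj
          rw [Finset.card_insert_of_notMem hv] at this
          omega
      refine (Finset.sum_le_sum fun b _ => hb b).trans ?_
      rw [Finset.sum_add_distrib, ← Finset.sum_filter, Finset.sum_const, Finset.sum_const,
        Finset.filter_mem_eq_inter, Finset.univ_inter, Finset.card_univ]
      have hcard : (S.image a).card ≤ S.card := Finset.card_image_le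
      simp only [smul_eq_mul]
      calc _ ≤ S.card * (M * Fintype.card A) + Fintype.card A * (e * (S.card + 1 + e) * M) := by
              gcongr
        _ = (S.card + e * (S.card + 1 + e)) * M * Fintype.card A := by ring
        _ ≤ _ := by
              gcongr
              nlinarith

open scoped Classical in
/-- The birthday bound without fixed values. -/
lemma DecTree.card_not_injOn_queried_le_sq {V A β : Type} [Fintype V] [DecidableEq V] [Fintype A]
    (T : DecTree V A β) {d : ℕ} (hT : T.depth ≤ d) :
    (Finset.univ.filter fun x : V → A => ¬ Set.InjOn x (queried x T)).card * Fintype.card A ≤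
      d ^ 2 * Fintype.card (V → A) := by
  rcases isEmpty_or_nonempty (V → A) with h | ⟨⟨a⟩⟩
  · simp
  · simpa [sq] using DecTree.card_not_injOn_queried_le T hT ∅ a (by simp)

open scoped Classical in
/-- A double count: if each `i` fails on less than half of all `x`, then some `x` makes more than
half of all `i` succeed. -/
lemma exists_card_lt_card_filter {ι α : Type} [Fintype ι] [Fintype α] [Nonempty ι]
    (good : ι → α → Prop)
    (h : ∀ i, 2 * (Finset.univ.filter fun x => ¬ good i x).card < Fintype.card α) :
    ∃ x, Fintype.card ι < 2 * (Finset.univ.filter fun i => good i x).card := by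
  by_contra! hcon
  have h1 : ∀ x, Fintype.card ι ≤ 2 * (Finset.univ.filter fun i => ¬ good i x).card := by
    intro x
    have := Finset.card_filter_add_card_filter_not (s := (Finset.univ : Finset ι))
      (fun i => good i x)
    rw [Finset.card_univ] at this
    have := hcon x
    omega
  have h2 : ∑ x, (Finset.univ.filter fun i => ¬ good i x).card =
      ∑ i, (Finset.univ.filter fun x => ¬ good i x).card := by
    simp only [Finset.card_filter]
    exact Finset.sum_comm
  have h3 : ∑ i, 2 * (Finset.univ.filter fun x => ¬ good i x).card <
      ∑ _i : ι, Fintype.card α :=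
    Finset.sum_lt_sum_of_nonempty Finset.univ_nonempty fun i _ => h i
  have h4 : ∑ _x : α, Fintype.card ι ≤
      ∑ x, 2 * (Finset.univ.filter fun i => ¬ good i x).card :=
    Finset.sum_le_sum fun x _ => h1 x
  rw [← Finset.mul_sum, ← h2] at h3
  rw [← Finset.mul_sum] at h4
  simp only [Finset.sum_const, Finset.card_univ, smul_eq_mul] at h3 h4
  rw [mul_comm] at h4
  omega

/-! ### No shallow Collision-formulations -/

/-- The positions `(x₁, x₂, y)` of `g` for which `(x₁, x₂)` is a collision of `f`. -/
def Selected {n : ℕ} (f : BitStr (n + 1) → BitStr n)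
    (p : BitStr (n + 1) × BitStr (n + 1) × BitStr (n + 1)) : Prop :=
  p.1 ≠ p.2.1 ∧ f p.1 = f p.2.1

/-- The input of NestedCollision that consists of `f` and of the function `g` whose values are set
to `0` wherever `(x₁, x₂)` is not a collision of `f`. -/
noncomputable def maskedInput {n : ℕ} (f : BitStr (n + 1) → BitStr n)
    (g : BitStr (n + 1) × BitStr (n + 1) × BitStr (n + 1) → BitStr n) :
    NestedCollision.Var n → NestedCollision.Alph n := by
  classical exact Sum.elim f fun p => if Selected f p then g p else fun _ => false

@[simp]
lemma maskedInput_inl {n : ℕ} (f : BitStr (n + 1) → BitStr n)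
    (g : BitStr (n + 1) × BitStr (n + 1) × BitStr (n + 1) → BitStr n) (x : BitStr (n + 1)) :
    maskedInput f g (Sum.inl x) = f x := rfl

lemma maskedInput_inr_of_selected {n : ℕ} {f : BitStr (n + 1) → BitStr n}
    {p : BitStr (n + 1) × BitStr (n + 1) × BitStr (n + 1)} (h : Selected f p)
    (g : BitStr (n + 1) × BitStr (n + 1) × BitStr (n + 1) → BitStr n) :
    maskedInput f g (Sum.inr p) = g p := if_pos h

lemma maskedInput_inr_of_not_selected {n : ℕ} {f : BitStr (n + 1) → BitStr n}
    {p : BitStr (n + 1) × BitStr (n + 1) × BitStr (n + 1)} (h : ¬ Selected f p)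
    (g : BitStr (n + 1) × BitStr (n + 1) × BitStr (n + 1) → BitStr n) :
    maskedInput f g (Sum.inr p) = fun _ => false := if_neg h

/-- The simulation by queries to `f` of a query to `f` and `g = 0`. A query `(x₁, x₂, y)` to `g`
looks at `x₁` and `x₂`, so that the simulation finds a collision of `f` if `(x₁, x₂)` is one. -/
def revealQuery {n : ℕ} :
    NestedCollision.Var n → DecTree (BitStr (n + 1)) (BitStr n) (NestedCollision.Alph n)
  | Sum.inl x => .query x .leaf
  | Sum.inr p => .query p.1 fun _ => .query p.2.1 fun _ => .leaf fun _ => false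

/-- The simulation by queries to `g` of a query to `maskedInput f g`. -/
noncomputable def maskedQuery {n : ℕ} (f : BitStr (n + 1) → BitStr n) :
    NestedCollision.Var n →
      DecTree (BitStr (n + 1) × BitStr (n + 1) × BitStr (n + 1)) (BitStr n)
        (NestedCollision.Alph n)
  | Sum.inl x => .leaf (f x)
  | Sum.inr p => by
      classical exact if Selected f p then .query p .leaf else .leaf fun _ => false

lemma eval_revealQuery {n : ℕ} (f : BitStr (n + 1) → BitStr n) :
    (fun v => (revealQuery v).eval f) = maskedInput f fun _ _ => false := by
  funext v
  rcases v with x | p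
  · rfl
  · exact (ite_self _).symm

lemma eval_maskedQuery {n : ℕ} (f : BitStr (n + 1) → BitStr n)
    (g : BitStr (n + 1) × BitStr (n + 1) × BitStr (n + 1) → BitStr n) :
    (fun v => (maskedQuery f v).eval g) = maskedInput f g := by
  funext v
  rcases v with x | p
  · rfl
  · by_cases h : Selected f p
    · simp only [maskedQuery, DecTree.eval, h, if_true]
      exact (maskedInput_inr_of_selected h g).symm
    · simp only [maskedQuery, DecTree.eval, h, if_false]
      exact (maskedInput_inr_of_not_selected h g).symm

/-- A tree whose simulation by queries to `f` finds no collision of `f` has an output that does not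
depend on `g` at the collisions of `f`. -/
lemma eval_maskedInput_eq_of_injOn {n : ℕ} {β : Type}
    (T : DecTree (NestedCollision.Var n) (NestedCollision.Alph n) β)
    (f : BitStr (n + 1) → BitStr n)
    (h : Set.InjOn f (DecTree.queried f (T.simulate revealQuery DecTree.leaf)))
    (g : BitStr (n + 1) × BitStr (n + 1) × BitStr (n + 1) → BitStr n) :
    T.eval (maskedInput f g) = T.eval (maskedInput f fun _ _ => false) := by
  refine DecTree.eval_congr T fun v hv => ?_
  rcases v with x | p
  · rfl
  · have hsub : DecTree.queried f (revealQuery (Sum.inr p)) ⊆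
        DecTree.queried f (T.simulate revealQuery DecTree.leaf) := by
      rw [DecTree.queried_simulate, eval_revealQuery]
      exact (Set.subset_biUnion_of_mem (u := fun v => DecTree.queried f (revealQuery v)) hv).trans
        Set.subset_union_left
    have hns : ¬ Selected f p := fun hp =>
      hp.1 (h (hsub (by simp [revealQuery, DecTree.queried]))
        (hsub (by simp [revealQuery, DecTree.queried])) hp.2)
    rw [maskedInput_inr_of_not_selected hns, maskedInput_inr_of_not_selected hns]

/-- A shallow tree fails to output a nested collision for a suitable choice of `g` at the collisions
of `f`. -/
lemma exists_not_rel_eval_maskedInput {n d : ℕ} (hd : (d + 2) ^ 2 < 2 ^ n)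
    (f : BitStr (n + 1) → BitStr n)
    (T : DecTree (NestedCollision.Var n) (NestedCollision.Alph n) (NestedCollision.Sol n))
    (hT : T.depth ≤ d) :
    ∃ g, ¬ NestedCollision.Rel n (maskedInput f g) (T.eval (maskedInput f g)) := by
  classical
  -- the two positions of `g` named by the output are queried as well
  let k : NestedCollision.Sol n →
      DecTree (BitStr (n + 1) × BitStr (n + 1) × BitStr (n + 1)) (BitStr n) Unit := fun s =>
    .query (s.1.1, s.1.2, s.2.1) fun _ => .query (s.1.1, s.1.2, s.2.2) fun _ => .leaf ()
  have hk : ∀ s, (k s).depth ≤ 2 := fun s =>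
    DecTree.depth_query_le fun _ => DecTree.depth_query_le fun _ => le_rfl
  have hσ : ∀ v, (maskedQuery f v).depth ≤ 1 := by
    rintro (x | p)
    · exact Nat.zero_le _
    · by_cases h : Selected f p
      · simp only [maskedQuery, h, if_true]
        exact DecTree.depth_query_le fun _ => le_rfl
      · simp [maskedQuery, h, DecTree.depth]
  have hdepth : (T.simulate (maskedQuery f) k).depth ≤ d + 2 := by
    simpa using DecTree.depth_simulate_le hσ hk T hT
  have hcount := DecTree.card_not_injOn_queried_le_sq _ hdepth
  obtain ⟨g, hg⟩ : ∃ g, Set.InjOn g (DecTree.queried g (T.simulate (maskedQuery f) k)) := by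
    by_contra! hcon
    rw [Finset.filter_true_of_mem fun g _ => hcon g, Finset.card_univ, mul_comm] at hcount
    have := Nat.le_of_mul_le_mul_right hcount Fintype.card_pos
    simp at this
    omega
  refine ⟨g, ?_⟩
  rw [DecTree.queried_simulate, eval_maskedQuery] at hg
  rintro ⟨⟨hx, hf⟩, hy, hgy⟩
  have hs1 : ∀ y, Selected f ((T.eval (maskedInput f g)).1.1,
      (T.eval (maskedInput f g)).1.2, y) := fun y => ⟨hx, hf⟩
  rw [maskedInput_inr_of_selected (hs1 _), maskedInput_inr_of_selected (hs1 _)] at hgy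
  have := hg (Or.inr (by simp [k, DecTree.queried])) (Or.inr (by simp [k, DecTree.queried])) hgy
  exact hy (congrArg (fun p => p.2.2) this)

/-- Formulations of depth `d` do not exist once `2 ^ n` exceeds `8 (d + 2)²`, whatever the size of
the Collision instance. -/
theorem not_depthLE_of_lt {n d : ℕ} (hd : 8 * (d + 2) ^ 2 < 2 ^ n)
    (F : NestedCollision.Formulation Collision n) : ¬ F.DepthLE d := by
  classical
  rintro ⟨hinst, hback⟩
  let good : BitStr (F.m + 1) → (BitStr (n + 1) → BitStr n) → Prop := fun w f =>
    Set.InjOn f (DecTree.queried f ((F.inst w).simulate revealQuery DecTree.leaf))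
  have hgood : ∀ w, 2 * (Finset.univ.filter fun f => ¬ good w f).card <
      Fintype.card (BitStr (n + 1) → BitStr n) := by
    intro w
    have hσ : ∀ v : NestedCollision.Var n, (revealQuery v).depth ≤ 2 := by
      rintro (x | p)
      · exact (DecTree.depth_query_le fun _ => Nat.zero_le _).trans one_le_two
      · exact DecTree.depth_query_le fun _ => DecTree.depth_query_le fun _ => le_rfl
    have hdepth := DecTree.depth_simulate_le (β := Collision.Alph F.m) (e := 0) hσ
      (k := DecTree.leaf) (fun _ => le_rfl) (F.inst w) (hinst w)
    have hcount := DecTree.card_not_injOn_queried_le_sq _ hdepth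
    have hM : 0 < Fintype.card (BitStr (n + 1) → BitStr n) := Fintype.card_pos
    have hA : Fintype.card (BitStr n) = 2 ^ n := by simp
    rw [hA] at hcount
    change (Finset.univ.filter fun f => ¬ good w f).card * 2 ^ n ≤ _ at hcount
    generalize Fintype.card (BitStr (n + 1) → BitStr n) = M at hcount hM ⊢
    generalize (Finset.univ.filter fun f => ¬ good w f).card = b at hcount ⊢
    by_contra! hcon
    have h1 : M * 2 ^ n ≤ 8 * (d + 2) ^ 2 * M := by
      calc M * 2 ^ n ≤ 2 * b * 2 ^ n := by gcongr
        _ ≤ 2 * ((2 * d + 0) ^ 2 * M) := by linarith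
        _ ≤ 8 * (d + 2) ^ 2 * M := by nlinarith
    rw [mul_comm] at h1
    exact absurd (Nat.le_of_mul_le_mul_right h1 hM) (not_le.2 hd)
  obtain ⟨f, hf⟩ := exists_card_lt_card_filter good hgood
  have hcard : (Finset.univ : Finset (BitStr F.m)).card <
      (Finset.univ.filter fun w => good w f).card := by
    simp only [Fintype.card_fun, Fintype.card_bool, Fintype.card_fin, pow_succ,
      Finset.card_univ] at hf ⊢
    omega
  obtain ⟨w₁, h₁, w₂, h₂, hne, heq⟩ := Finset.exists_ne_map_eq_of_card_lt_of_maps_to hcard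
    (f := fun w => (F.inst w).eval (maskedInput f fun _ _ => false))
    fun w _ => Finset.mem_univ _
  have hd' : (d + 2) ^ 2 < 2 ^ n := by omega
  obtain ⟨g, hg⟩ := exists_not_rel_eval_maskedInput hd' f (F.back (w₁, w₂)) (hback _)
  refine hg (F.correct _ (w₁, w₂) ⟨hne, ?_⟩)
  change (F.inst w₁).eval (maskedInput f g) = (F.inst w₂).eval (maskedInput f g)
  rw [eval_maskedInput_eq_of_injOn _ f (Finset.mem_filter.1 h₁).2,
    eval_maskedInput_eq_of_injOn _ f (Finset.mem_filter.1 h₂).2]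
  exact heq

/-! ### Polynomial growth -/

open Filter Asymptotics in
lemma Polynomial.exists_eval_lt_two_pow (p : Polynomial ℕ) : ∃ n, p.eval n < 2 ^ n := by
  have h : (fun n : ℕ => ((p.eval n : ℕ) : ℝ)) =o[atTop] fun n : ℕ => (2 : ℝ) ^ n := by
    induction p using Polynomial.induction_on' with
    | add p q hp hq => simpa using hp.add hq
    | monomial k c =>
      simpa using (isLittleO_pow_const_const_pow_of_one_lt (R := ℝ) k one_lt_two).const_mul_left c
  obtain ⟨n, hn⟩ := (h.bound (c := 1 / 2) (by norm_num)).exists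
  refine ⟨n, ?_⟩
  have hpos : (0 : ℝ) < 2 ^ n := by positivity
  have : ((p.eval n : ℕ) : ℝ) < 2 ^ n := by
    rw [Real.norm_of_nonneg (by positivity), Real.norm_of_nonneg (by positivity)] at hn
    linarith
  exact_mod_cast this

lemma Polynomial.eval_mono_nat (p : Polynomial ℕ) : Monotone fun n => p.eval n := by
  intro a b h
  simp only [Polynomial.eval_eq_sum, Polynomial.sum]
  gcongr

/-! ### Sizes of the two problems -/

lemma card_bitStr (n : ℕ) : Fintype.card (BitStr n) = 2 ^ n := by simp

lemma logSize_collision (n : ℕ) : Collision.logSize n = 2 * n + 1 := by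
  have h1 : Fintype.card (Collision.Var n) = 2 ^ (n + 1) := card_bitStr (n + 1)
  have h2 : Fintype.card (Collision.Alph n) = 2 ^ n := card_bitStr n
  rw [QueryProblem.logSize, h1, h2, Nat.clog_pow _ _ one_lt_two, Nat.clog_pow _ _ one_lt_two]
  omega

lemma card_var_nestedCollision (n : ℕ) :
    Fintype.card (NestedCollision.Var n) = 2 ^ (n + 1) + 2 ^ (3 * n + 3) := by
  have h : Fintype.card (BitStr (n + 1) ⊕ (BitStr (n + 1) × BitStr (n + 1) × BitStr (n + 1))) =
      2 ^ (n + 1) + 2 ^ (3 * n + 3) := by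
    simp only [Fintype.card_sum, Fintype.card_prod, card_bitStr]
    ring
  exact h

lemma card_alph_nestedCollision (n : ℕ) : Fintype.card (NestedCollision.Alph n) = 2 ^ n :=
  card_bitStr n

lemma logSize_nestedCollision_le (n : ℕ) : NestedCollision.logSize n ≤ 4 * n + 4 := by
  have h : Nat.clog 2 (2 ^ (n + 1) + 2 ^ (3 * n + 3)) ≤ 3 * n + 4 := by
    refine Nat.clog_le_of_le_pow ?_
    have : 2 ^ (n + 1) ≤ 2 ^ (3 * n + 3) := Nat.pow_le_pow_right two_pos (by omega)
    rw [pow_succ 2 (3 * n + 3)]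
    omega
  rw [QueryProblem.logSize, card_var_nestedCollision, card_alph_nestedCollision,
    Nat.clog_pow _ _ one_lt_two]
  omega

lemma le_logSize_nestedCollision (n : ℕ) : n ≤ NestedCollision.logSize n := by
  rw [QueryProblem.logSize, card_alph_nestedCollision, Nat.clog_pow _ _ one_lt_two]
  omega

theorem not_hasShallowFormulation_collision :
    ¬ NestedCollision.HasShallowFormulation Collision := by
  rintro ⟨p, hp⟩
  -- the bound of `not_depthLE_of_lt` for the depth `p (4 n + 4)`, as `logSize` is at most `4 n + 4`
  obtain ⟨n, hn⟩ := Polynomial.exists_eval_lt_two_pow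
    (8 * ((p.comp (4 * Polynomial.X + 4)) + 2) ^ 2)
  obtain ⟨F, hF⟩ := hp n
  refine not_depthLE_of_lt (d := p.eval (NestedCollision.logSize n)) ?_ F hF
  refine lt_of_le_of_lt ?_ hn
  have := p.eval_mono_nat (logSize_nestedCollision_le n)
  simp at this ⊢
  gcongr

/-! ### Membership in TFNP and the adaptive algorithm -/

lemma exists_collision {n : ℕ} (C : BitStr (n + 1) → BitStr n) :
    ∃ x y, x ≠ y ∧ C x = C y :=
  Fintype.exists_ne_map_eq_of_card_lt C <| by
    simp only [Fintype.card_fun, Fintype.card_bool, Fintype.card_fin]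
    exact Nat.pow_lt_pow_right one_lt_two (Nat.lt_succ_self n)

open DecTree in
theorem nestedCollision_inTFNP : NestedCollision.InTFNP := by
  classical
  refine ⟨fun n h => ?_, 4 * Polynomial.X + 4, fun n => ⟨?_, fun s => ?_⟩⟩
  · obtain ⟨x₁, x₂, hx⟩ := exists_collision fun x : BitStr (n + 1) => h (Sum.inl x)
    obtain ⟨y₁, y₂, hy⟩ := exists_collision fun y : BitStr (n + 1) => h (Sum.inr (x₁, x₂, y))
    exact ⟨((x₁, x₂), (y₁, y₂)), hx, hy⟩
  · have hcard : Fintype.card (NestedCollision.Sol n) = 2 ^ (4 * n + 4) := by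
      have h : Fintype.card
          ((BitStr (n + 1) × BitStr (n + 1)) × (BitStr (n + 1) × BitStr (n + 1))) =
            2 ^ (4 * n + 4) := by
        simp only [Fintype.card_prod, card_bitStr]
        ring
      exact h
    have := le_logSize_nestedCollision n
    rw [hcard, Nat.clog_pow _ _ one_lt_two]
    simp
    omega
  · refine ⟨query (Sum.inl s.1.1) fun a => query (Sum.inl s.1.2) fun b =>
      query (Sum.inr (s.1.1, s.1.2, s.2.1)) fun c =>
      query (Sum.inr (s.1.1, s.1.2, s.2.2)) fun e =>
      leaf (decide ((s.1.1 ≠ s.1.2 ∧ a = b) ∧ (s.2.1 ≠ s.2.2 ∧ c = e))), ?_, fun x => ?_⟩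
    · refine (depth_query_le (d := 3) fun _ => depth_query_le fun _ => depth_query_le fun _ =>
        depth_query_le fun _ => le_rfl).trans ?_
      simp
    · simp only [eval, decide_eq_true_eq]
      rfl

open DecTree in
theorem collision_inTFNP : Collision.InTFNP := by
  classical
  refine ⟨fun n C => ?_, 2 * Polynomial.X + 2, fun n => ⟨?_, fun s => ?_⟩⟩
  · obtain ⟨x₁, x₂, hx⟩ := exists_collision C
    exact ⟨(x₁, x₂), hx⟩
  · have hcard : Fintype.card (Collision.Sol n) = 2 ^ (2 * n + 2) := by
      have h : Fintype.card (BitStr (n + 1) × BitStr (n + 1)) = 2 ^ (2 * n + 2) := by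
        simp only [Fintype.card_prod, card_bitStr]
        ring
      exact h
    rw [hcard, Nat.clog_pow _ _ one_lt_two, logSize_collision]
    simp
    omega
  · refine ⟨query s.1 fun a => query s.2 fun b => leaf (decide (s.1 ≠ s.2 ∧ a = b)), ?_,
      fun x => ?_⟩
    · refine (depth_query_le (d := 1) fun _ => depth_query_le fun _ => le_rfl).trans ?_
      simp
    · simp only [eval, decide_eq_true_eq]
      rfl

/-- The identity is a many-one reduction. -/
theorem QueryProblem.manyOneReducible_refl (R : QueryProblem) : R.ManyOneReducible R := by
  refine ⟨Polynomial.X + 1, fun n => ⟨⟨n, fun v => .query v .leaf, fun s => .leaf s, ?_⟩,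
    ⟨fun v => ?_, fun s => Nat.zero_le _⟩, by simp⟩⟩
  · intro x s h
    exact h
  · refine (DecTree.depth_query_le (d := 0) fun _ => le_rfl).trans ?_
    simp

lemma QueryProblem.OracleTree.cost_call_le {S : QueryProblem} {V A β : Type} [Fintype A] {m d c : ℕ}
    {inst : S.Var m → DecTree V A (S.Alph m)} {next : S.Sol m → OracleTree S V A β}
    (hinst : ∀ v, (inst v).depth ≤ d) (hnext : ∀ s, (next s).cost ≤ c) :
    (OracleTree.call m inst next).cost ≤ 1 + S.logSize m + d + c := by
  have h1 := Finset.sup_le (s := Finset.univ) fun v _ => hinst v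
  have h2 := Finset.sup_le (s := Finset.univ) fun s _ => hnext s
  simp only [cost]
  omega

/-- The adaptive algorithm: a collision `(x₁, x₂)` of `f`, then one of `g (x₁, x₂, ·)`. -/
def nestedCollisionTree (n : ℕ) :
    QueryProblem.OracleTree Collision (NestedCollision.Var n) (NestedCollision.Alph n)
      (NestedCollision.Sol n) :=
  .call n (fun x => .query (Sum.inl x) .leaf) fun s =>
    .call n (fun y => .query (Sum.inr (s.1, s.2, y)) .leaf) fun t => .leaf (s, t)

lemma solvedBy_nestedCollisionTree (n : ℕ) :
    QueryProblem.SolvedBy NestedCollision Collision n (nestedCollisionTree n) := by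
  rintro x b ⟨s, hs, t, ht, rfl⟩
  exact ⟨hs, ht⟩

lemma cost_nestedCollisionTree_le (n : ℕ) :
    (nestedCollisionTree n).cost ≤ 4 * n + 6 := by
  refine (QueryProblem.OracleTree.cost_call_le (d := 1) (c := 2 * n + 3)
    (fun _ => DecTree.depth_query_le fun _ => le_rfl) fun s => ?_).trans ?_
  · refine (QueryProblem.OracleTree.cost_call_le (d := 1) (c := 0)
      (fun _ => DecTree.depth_query_le fun _ => le_rfl) fun _ => le_rfl).trans ?_
    rw [logSize_collision]
    omega
  · rw [logSize_collision]
    omega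

lemma calls_nestedCollisionTree_le (n : ℕ) : (nestedCollisionTree n).calls ≤ 2 := by
  simp only [nestedCollisionTree, QueryProblem.OracleTree.calls]
  have : ∀ s : Collision.Sol n, 1 + (Finset.univ.sup fun _ : Collision.Sol n => 0) ≤ 1 := by
    simp
  have := Finset.sup_le (s := Finset.univ) fun s _ => this s
  omega

/-- NestedCollision has no Collision-formulation of polylogarithmic depth, although it is a total
search problem in black-box TFNP that polylogarithmically shallow oracle decision trees solve with
at most two adaptive calls to Collision. Hence black-box PWPP is not closed under adaptive Turing
reductions. -/
theorem mainTheorem1 :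
    ¬ NestedCollision.HasShallowFormulation Collision ∧
    (NestedCollision.InTFNP ∧
      ∃ p : Polynomial ℕ, ∀ n,
        ∃ T : QueryProblem.OracleTree Collision
            (NestedCollision.Var n) (NestedCollision.Alph n) (NestedCollision.Sol n),
          QueryProblem.SolvedBy NestedCollision Collision n T ∧
          T.cost ≤ p.eval (NestedCollision.logSize n) ∧ T.calls ≤ 2) ∧
    ¬ PWPPTuringClosed := by
  have hcost : ∀ n, (nestedCollisionTree n).cost ≤
      (4 * Polynomial.X + 6 : Polynomial ℕ).eval (NestedCollision.logSize n) := by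
    intro n
    have h1 := cost_nestedCollisionTree_le n
    have h2 := le_logSize_nestedCollision n
    simp
    omega
  refine ⟨not_hasShallowFormulation_collision, ⟨nestedCollision_inTFNP, _, fun n =>
    ⟨nestedCollisionTree n, solvedBy_nestedCollisionTree n, hcost n,
      calls_nestedCollisionTree_le n⟩⟩, fun hclosed => ?_⟩
  obtain ⟨-, p, hp⟩ := hclosed NestedCollision Collision nestedCollision_inTFNP
    ⟨collision_inTFNP, Collision.manyOneReducible_refl⟩
    ⟨_, fun n => ⟨nestedCollisionTree n, solvedBy_nestedCollisionTree n, hcost n⟩⟩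
  exact not_hasShallowFormulation_collision ⟨p, fun n => (hp n).imp fun F hF => hF.1⟩
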